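/- Let $G$ be a finite simple graph on $n$ vertices that is unicyclic, i.e. contains exactly one cycle $C$ (connectedness is not needed), and let $m$ be the length of $C$. Let $\Phi=(G,\varphi)$ be a complex unit gain graph: $\varphi$ assigns to every oriented edge $e_{ij}$ of $G$ a complex number of modulus $1$ with $\varphi(e_{ji})=\varphi(e_{ij})^{-1}$. Let $A(\Phi)$ be the matrix with $(i,j)$ entry $\varphi(e_{ij})$ if $v_i\sim v_j$ and $0$ otherwise, let $A(G)$ be the adjacency matrix of $G$, and let $Q_\Phi(x)=\operatorname{per}(xI-A(\Phi))$ and $Q_G(x)=\operatorname{per}(xI-A(G))$ be the permanental polynomials. Suppose that the gain of $C$, i.e. the product of the gains of its edges along some orientation of $C$, is $\varphi(C)=e^{i\theta}$ with $\theta\in\mathbb{R}$. Then $$Q_\Phi(x)=Q_G(x)+(-1)^{m+1}\,2(1-\cos\theta)\sum_{i=0}^{k} m_i(G-C)\,x^{\,n-m-2i},$$ where $G-C$ is the graph obtained from $G$ by deleting the vertices of $C$, $m_i(G-C)$ is the number of matchings of size $i$ in $G-C$ (so $m_0(G-C)=1$), and $k$ is the matching number of $G-C$, i.e. the largest size of a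 matching in $G-C$. -/

import Mathlib

open Polynomial

noncomputable section

namespace SimpleGraph

variable {V : Type*}

/-- A graph is unicyclic if it contains exactly one cycle. Cycles are counted as subgraphs, so that
the choices of a starting point and of a direction of traversal do not matter. Connectedness is
not required. -/
def IsUnicyclic (G : SimpleGraph V) : Prop :=
  ∃! H : G.Subgraph, ∃ (u : V) (p : G.Walk u u), p.IsCycle ∧ p.toSubgraph = H

/-- A set of edges of `G` is a matching if no two of its members have a vertex in common. -/
def IsEdgeMatching (G : SimpleGraph V) (M : Finset (Sym2 V)) : Prop :=
  (∀ e ∈ M, e ∈ G.edgeSet) ∧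
    ∀ e ∈ M, ∀ f ∈ M, e ≠ f → ∀ v : V, ¬ (v ∈ e ∧ v ∈ f)

/-- The number `m_i(G)` of matchings of size `i` in a finite graph. -/
def numMatchings (G : SimpleGraph V) (i : ℕ) : ℕ :=
  {M : Finset (Sym2 V) | G.IsEdgeMatching M ∧ M.card = i}.ncard

/-- The matching number of a finite graph: the largest size of a matching. -/
def matchingNumber (G : SimpleGraph V) : ℕ :=
  sSup {i : ℕ | ∃ M : Finset (Sym2 V), G.IsEdgeMatching M ∧ M.card = i}

/-- The graph `G - C`: all vertices of the closed walk `C` are deleted, together with the edges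
incident to them. -/
def deleteWalkVerts (G : SimpleGraph V) {u : V} (C : G.Walk u u) :
    SimpleGraph {v : V // v ∉ C.support} :=
  G.induce {v : V | v ∉ C.support}

/-- A complex unit gain function on `G`: every oriented edge (dart) carries a complex number of
modulus one, and the opposite orientation carries its inverse. -/
structure UnitGain (G : SimpleGraph V) where
  /-- The gain of an oriented edge. -/
  gain : G.Dart → Circle
  /-- Opposite orientations have inverse gains. -/
  gain_symm : ∀ d : G.Dart, gain d.symm = (gain d)⁻¹

namespace UnitGain

variable {G : SimpleGraph V}

/-- The gain of a walk, in particular of an oriented cycle: the product of the gains of its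
edges, oriented in the direction of traversal. -/
def walkGain (φ : G.UnitGain) {u v : V} (p : G.Walk u v) : Circle :=
  (p.darts.map φ.gain).prod

/-- The adjacency matrix `A(Φ)` of the gain graph `Φ = (G, φ)`. -/
def adjMatrix (φ : G.UnitGain) [DecidableRel G.Adj] : Matrix V V ℂ :=
  Matrix.of fun i j => if h : G.Adj i j then (φ.gain ⟨(i, j), h⟩ : ℂ) else 0

end UnitGain

end SimpleGraph

/-- The permanental polynomial `per (x I - A)` of a square complex matrix. -/
def Matrix.permanentalPoly {V : Type*} [Fintype V] [DecidableEq V] (A : Matrix V V ℂ) : ℂ[X] :=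
  (Matrix.charmatrix A).permanent

end

/-! ### Long orbits of permutations as cycles of the graph. -/

namespace SimpleGraph

variable {V : Type*}

/-! Expand the permanent over permutations `σ`. A term vanishes unless `σ` sends every moved vertex
to a neighbour. If such a `σ` is an involution, opposite entries multiply to `1` and the term is a
power of `X` free of gains (`prod_charmatrix_of_involutive`). Otherwise `σ` has an orbit of length
at least three, which traverses a cycle of `G` (`exists_isCycle_of_perm`); that cycle is `C`, and on
it `σ` is the rotation or its inverse (`eqOn_rotation_of_not_involutive`).

The two rotations contribute `(-1)^m (γ⁻¹ + γ) S`, where `γ` is the gain of `C` and `S` is the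
permanental polynomial of `G - C`. Since `G - C` is acyclic, only involutions survive there, and
these are its matchings, so `S` is gain-free (`permanentalPoly_of_isAcyclic`).

Thus `Q_Φ = R + (-1)^m (γ⁻¹ + γ) S` with `R` independent of the gains (`exists_permanentalPoly_eq`).
Comparing `γ⁻¹ + γ = 2 cos θ` with the value `2` for trivial gains gives the theorem. -/

lemma exists_walk_iterate {G : SimpleGraph V} {f : V → V} {v : V}
    (h : ∀ i, G.Adj (f^[i] v) (f^[i + 1] v)) (n : ℕ) :
    ∃ p : G.Walk v (f^[n] v), p.support = (List.range (n + 1)).map (fun i => f^[i] v) ∧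
      p.edges = (List.range n).map fun i => s(f^[i] v, f^[i + 1] v) := by
  induction n with
  | zero => exact ⟨Walk.nil, by simp, by simp⟩
  | succ n ih =>
    obtain ⟨p, hp, hp'⟩ := ih
    refine ⟨p.concat (h n), ?_, ?_⟩
    · rw [Walk.support_concat, hp, List.range_succ (n := n + 1)]
      simp
    · rw [Walk.edges_concat, hp', List.range_succ]
      simp

/-- An orbit of length at least three of a permutation which moves vertices along edges only
is traversed by a cycle of the graph. -/
lemma exists_isCycle_of_perm [Finite V] {G : SimpleGraph V} {σ : Equiv.Perm V}
    (hσ : ∀ w, σ w ≠ w → G.Adj w (σ w)) {v : V} (hv : σ (σ v) ≠ v) :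
    ∃ (u : V) (p : G.Walk u u), p.IsCycle ∧ v ∈ p.support ∧
      ∀ w ∈ p.support, σ (σ w) ≠ w ∧ p.toSubgraph.Adj w (σ w) := by
  have hit : ∀ i, σ (σ (σ^[i] v)) ≠ σ^[i] v := by
    intro i h
    apply hv
    apply (σ.injective.iterate i)
    rw [← Function.iterate_succ_apply, ← Function.iterate_succ_apply,
      Function.iterate_succ_apply', Function.iterate_succ_apply', h]
  have hadj : ∀ i, G.Adj (σ^[i] v) (σ^[i + 1] v) := by
    intro i
    rw [Function.iterate_succ_apply']
    refine hσ _ fun h => hit i ?_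
    rw [h, h]
  -- Finiteness rules out period `0`, and `hv` rules out periods `1` and `2`.
  obtain ⟨n, hn⟩ : ∃ n, Function.minimalPeriod σ v = n + 3 := by
    have h0 : Function.minimalPeriod σ v ≠ 0 :=
      (Function.minimalPeriod_pos_of_mem_periodicPts
        (σ.injective.mem_periodicPts v)).ne'
    have h1 : Function.minimalPeriod σ v ≠ 1 := fun h => by
      have := Function.iterate_minimalPeriod (f := σ) (x := v)
      rw [h] at this
      simp only [Function.iterate_one] at this
      exact hv (by rw [this, this])
    have h2 : Function.minimalPeriod σ v ≠ 2 := fun h => by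
      have := Function.iterate_minimalPeriod (f := σ) (x := v)
      rw [h] at this
      exact hv this
    exact ⟨Function.minimalPeriod σ v - 3, by omega⟩
  have hper : σ^[n + 3] v = v := hn ▸ Function.iterate_minimalPeriod
  have hinj : ∀ i < n + 3, ∀ j < n + 3, σ^[i] v = σ^[j] v → i = j := by
    intro i hi j hj h
    exact Function.iterate_injOn_Iio_minimalPeriod (f := σ) (x := v)
      (by simpa [hn] using hi) (by simpa [hn] using hj) h
  obtain ⟨p, hp, hp'⟩ := exists_walk_iterate hadj (n + 2)
  have hlast : G.Adj (σ^[n + 2] v) v := by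
    have := hadj (n + 2)
    rwa [hper] at this
  have hedges : ∀ i < n + 3, s(σ^[i] v, σ^[i + 1] v) ∈ (Walk.cons hlast p).edges := by
    intro i hi
    rw [Walk.edges_cons, hp']
    rcases Nat.lt_succ_iff_lt_or_eq.mp hi with h | rfl
    · exact List.mem_cons_of_mem _ (List.mem_map.mpr ⟨i, List.mem_range.mpr h, rfl⟩)
    · rw [hper]
      exact List.mem_cons_self
  -- The path `p` visits all `n + 3` orbit points; the closing edge is put in front, so the cycle is
  -- based at the last of them.
  refine ⟨_, Walk.cons hlast p, ?_, ?_, ?_⟩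
  · rw [Walk.cons_isCycle_iff, Walk.isPath_def, hp, hp']
    constructor
    · refine List.Nodup.map_on ?_ List.nodup_range
      intro i hi j hj h
      exact hinj i (List.mem_range.mp hi) j (List.mem_range.mp hj) h
    · intro h
      obtain ⟨i, hi, h⟩ := List.mem_map.mp h
      have hi := List.mem_range.mp hi
      rcases Sym2.eq_iff.mp h with ⟨h1, -⟩ | ⟨h1, h2⟩
      · have := hinj i (by omega) (n + 2) (by omega) h1
        omega
      · have h3 := hinj i (by omega) 0 (by omega) h1
        have h4 := hinj (i + 1) (by omega) (n + 2) (by omega) h2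
        omega
  · rw [Walk.support_cons]
    exact List.mem_cons_of_mem _ p.start_mem_support
  · intro w hw
    obtain ⟨i, hi, rfl⟩ : ∃ i < n + 3, σ^[i] v = w := by
      rw [Walk.support_cons, hp, List.mem_cons] at hw
      rcases hw with rfl | hw
      · exact ⟨n + 2, by omega, rfl⟩
      · obtain ⟨i, hi, h⟩ := List.mem_map.mp hw
        exact ⟨i, List.mem_range.mp hi, h⟩
    refine ⟨hit i, ?_⟩
    rw [Walk.adj_toSubgraph_iff_mem_edges, ← Function.iterate_succ_apply' (⇑σ)]
    exact hedges i hi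

end SimpleGraph

/-! ### Terms of the permanent for gain matrices. -/

/-- The entries of `A` at the two orientations of an edge are inverse to each other, and the
remaining entries vanish. -/
structure Matrix.IsGainMatrix {V : Type*} (A : Matrix V V ℂ) (G : SimpleGraph V) : Prop where
  eq_zero : ∀ i j, ¬ G.Adj i j → A i j = 0
  mul_eq_one : ∀ i j, G.Adj i j → A i j * A j i = 1

namespace Matrix.IsGainMatrix

variable {V : Type*} {A : Matrix V V ℂ} {G : SimpleGraph V}

lemma apply_self (hA : A.IsGainMatrix G) (i : V) : A i i = 0 :=
  hA.eq_zero i i (G.loopless.irrefl i)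

variable [Fintype V] [DecidableEq V]

lemma prod_charmatrix_eq_zero (hA : A.IsGainMatrix G) {σ : Equiv.Perm V}
    (hσ : ¬ ∀ w, σ w ≠ w → G.Adj w (σ w)) : ∏ i, A.charmatrix (σ i) i = 0 := by
  push Not at hσ
  obtain ⟨w, hw, hadj⟩ := hσ
  refine Finset.prod_eq_zero (Finset.mem_univ w) ?_
  rw [Matrix.charmatrix_apply_ne _ _ _ hw, hA.eq_zero _ _ (fun h => hadj h.symm)]
  simp

/-- On each swapped pair the two signs cancel and the two entries are inverse; each fixed point
contributes `X` because the diagonal of `A` is zero. -/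
lemma prod_charmatrix_of_involutive (hA : A.IsGainMatrix G) {σ : Equiv.Perm V}
    (hσ : ∀ w, σ w ≠ w → G.Adj w (σ w)) (hσ2 : Function.Involutive σ) :
    ∏ i, A.charmatrix (σ i) i = X ^ (Fintype.card V - σ.support.card) := by
  rw [← Finset.prod_mul_prod_compl σ.support]
  have h1 : ∏ i ∈ σ.support, A.charmatrix (σ i) i = 1 := by
    refine Finset.prod_involution (fun i _ => σ i) ?_ ?_ ?_ ?_
    · intro i hi
      have hi := Equiv.Perm.mem_support.mp hi
      rw [hσ2 i, Matrix.charmatrix_apply_ne _ _ _ hi, Matrix.charmatrix_apply_ne _ _ _ hi.symm,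
        neg_mul_neg, ← Polynomial.C_mul, hA.mul_eq_one _ _ (hσ i hi).symm, Polynomial.C_1]
    · intro i hi _
      exact Equiv.Perm.mem_support.mp hi
    · intro i hi
      exact Equiv.Perm.apply_mem_support.mpr hi
    · intro i hi
      exact hσ2 i
  have h2 : ∏ i ∈ σ.supportᶜ, A.charmatrix (σ i) i = ∏ i ∈ σ.supportᶜ, (X : ℂ[X]) := by
    refine Finset.prod_congr rfl fun i hi => ?_
    have hi : σ i = i := by simpa using hi
    rw [hi, Matrix.charmatrix_apply_eq, hA.apply_self]
    simp
  rw [h1, h2, one_mul, Finset.prod_const, Finset.card_compl]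

end Matrix.IsGainMatrix

/-! ### Involutions along edges correspond to matchings. -/

namespace Equiv.Perm

variable {V : Type*} [Fintype V] [DecidableEq V]

/-- The pairs of distinct vertices which an involution interchanges. -/
def swappedPairs (σ : Perm V) : Finset (Sym2 V) :=
  σ.support.image fun v => s(v, σ v)

lemma mem_swappedPairs_and_mem {σ : Perm V} (hσ : Function.Involutive σ) {e : Sym2 V} {x : V} :
    (e ∈ σ.swappedPairs ∧ x ∈ e) ↔ (e = s(x, σ x) ∧ σ x ≠ x) := by
  constructor
  · rintro ⟨he, hx⟩
    obtain ⟨v, hv, rfl⟩ := Finset.mem_image.mp he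
    have hv := mem_support.mp hv
    rcases Sym2.mem_iff.mp hx with rfl | rfl
    · exact ⟨rfl, hv⟩
    · rw [hσ v]
      exact ⟨Sym2.eq_swap, hv.symm⟩
  · rintro ⟨rfl, hx⟩
    exact ⟨Finset.mem_image.mpr ⟨x, mem_support.mpr hx, rfl⟩, Sym2.mem_mk_left _ _⟩

lemma swappedPairs_injective {σ τ : Perm V} (hσ : Function.Involutive σ)
    (hτ : Function.Involutive τ) (h : σ.swappedPairs = τ.swappedPairs) : σ = τ := by
  have key : ∀ {σ τ : Perm V}, Function.Involutive σ → Function.Involutive τ →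
      σ.swappedPairs = τ.swappedPairs → ∀ x, σ x ≠ x → σ x = τ x := by
    intro σ τ hσ hτ h x hx
    have := (mem_swappedPairs_and_mem hσ).mpr ⟨rfl, hx⟩
    rw [h, mem_swappedPairs_and_mem hτ] at this
    exact Sym2.congr_right.mp this.1
  ext x
  by_cases hx : σ x = x
  · by_cases hx' : τ x = x
    · rw [hx, hx']
    · exact (key hτ hσ h.symm x hx').symm
  · exact key hσ hτ h x hx

lemma card_support_eq_two_mul_card_swappedPairs {σ : Perm V} (hσ : Function.Involutive σ) :
    σ.support.card = 2 * σ.swappedPairs.card := by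
  rw [Finset.card_eq_sum_card_image (fun v => s(v, σ v)) σ.support, mul_comm]
  refine Finset.sum_const_nat fun e he => ?_
  obtain ⟨v, hv, rfl⟩ := Finset.mem_image.mp he
  have hv' := mem_support.mp hv
  have : σ.support.filter (fun w => s(w, σ w) = s(v, σ v)) = {v, σ v} := by
    ext w
    simp only [Finset.mem_filter, Finset.mem_insert, Finset.mem_singleton, mem_support]
    constructor
    · rintro ⟨-, h⟩
      exact Sym2.mem_iff.mp (h ▸ Sym2.mem_mk_left w (σ w))
    · rintro (rfl | rfl)
      · exact ⟨hv', rfl⟩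
      · rw [hσ v]
        exact ⟨hv'.symm, Sym2.eq_swap⟩
  rw [this, Finset.card_pair hv'.symm]

end Equiv.Perm

namespace SimpleGraph

variable {V : Type*} [Fintype V] [DecidableEq V] {G : SimpleGraph V}

lemma isEdgeMatching_swappedPairs {σ : Equiv.Perm V} (hσ : Function.Involutive σ)
    (hG : ∀ w, σ w ≠ w → G.Adj w (σ w)) : G.IsEdgeMatching σ.swappedPairs := by
  constructor
  · intro e he
    obtain ⟨v, hv, rfl⟩ := Finset.mem_image.mp he
    exact hG v (Equiv.Perm.mem_support.mp hv)
  · rintro e he f hf hef v ⟨hve, hvf⟩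
    exact hef (((Equiv.Perm.mem_swappedPairs_and_mem hσ).mp ⟨he, hve⟩).1.trans
      ((Equiv.Perm.mem_swappedPairs_and_mem hσ).mp ⟨hf, hvf⟩).1.symm)

lemma IsEdgeMatching.exists_perm {M : Finset (Sym2 V)} (hM : G.IsEdgeMatching M) :
    ∃ σ : Equiv.Perm V, Function.Involutive σ ∧ (∀ w, σ w ≠ w → G.Adj w (σ w)) ∧
      σ.swappedPairs = M := by
  classical
  -- A covered vertex goes to the other end of its edge, an uncovered one stays. The chosen edge is
  -- the only one available, because `M` is a matching.
  let f : V → V := fun v =>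
    if h : ∃ e ∈ M, v ∈ e then Sym2.Mem.other h.choose_spec.2 else v
  have hf : ∀ e ∈ M, ∀ v ∈ e, s(v, f v) = e := by
    intro e he v hv
    have h : ∃ e ∈ M, v ∈ e := ⟨e, he, hv⟩
    have : s(v, f v) = h.choose := by
      simp only [f, dif_pos h]
      exact Sym2.other_spec h.choose_spec.2
    rw [this]
    by_contra hne
    exact hM.2 _ h.choose_spec.1 e he hne v ⟨h.choose_spec.2, hv⟩
  have hf' : ∀ v, f v ≠ v → s(v, f v) ∈ M := by
    intro v hv
    by_cases h : ∃ e ∈ M, v ∈ e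
    · obtain ⟨e, he, hve⟩ := h
      rw [hf e he v hve]
      exact he
    · exact absurd (dif_neg h) hv
  have hinv : Function.Involutive f := by
    intro v
    by_cases h : f v = v
    · rw [h, h]
    · have := hf _ (hf' v h) (f v) (Sym2.mem_mk_right _ _)
      rw [Sym2.eq_swap] at this
      exact Sym2.congr_left.mp this
  refine ⟨hinv.toPerm f, hinv, fun w hw => hM.1 _ (hf' w hw), ?_⟩
  ext e
  constructor
  · intro he
    obtain ⟨v, hv, rfl⟩ := Finset.mem_image.mp he
    exact hf' v (Equiv.Perm.mem_support.mp hv)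
  · intro he
    induction e with
    | _ a b =>
      have hab : f a = b := Sym2.congr_right.mp (hf _ he a (Sym2.mem_mk_left _ _))
      refine Finset.mem_image.mpr ⟨a, Equiv.Perm.mem_support.mpr ?_, ?_⟩
      · have : G.Adj a b := hM.1 _ he
        simpa [hab] using this.ne'
      · simp [hab]

open Classical in
lemma sum_involutive_eq_sum_matchings {R : Type*} [AddCommMonoid R] (F : ℕ → R) :
    ∑ σ ∈ Finset.univ.filter (fun σ : Equiv.Perm V =>
        Function.Involutive σ ∧ ∀ w, σ w ≠ w → G.Adj w (σ w)),
      F σ.support.card = ∑ M : Finset (Sym2 V) with G.IsEdgeMatching M, F (2 * M.card) := by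
  refine Finset.sum_bij (fun σ _ => σ.swappedPairs) ?_ ?_ ?_ ?_
  · intro σ hσ
    obtain ⟨-, h1, h2⟩ := Finset.mem_filter.mp hσ
    exact Finset.mem_filter.mpr ⟨Finset.mem_univ _, isEdgeMatching_swappedPairs h1 h2⟩
  · intro σ hσ τ hτ h
    exact Equiv.Perm.swappedPairs_injective (Finset.mem_filter.mp hσ).2.1
      (Finset.mem_filter.mp hτ).2.1 h
  · intro M hM
    obtain ⟨σ, h1, h2, h3⟩ := (Finset.mem_filter.mp hM).2.exists_perm
    exact ⟨σ, Finset.mem_filter.mpr ⟨Finset.mem_univ _, h1, h2⟩, h3⟩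
  · intro σ hσ
    rw [Equiv.Perm.card_support_eq_two_mul_card_swappedPairs (Finset.mem_filter.mp hσ).2.1]

lemma IsEdgeMatching.card_le_matchingNumber {V : Type*} [Fintype V] {G : SimpleGraph V}
    {M : Finset (Sym2 V)} (hM : G.IsEdgeMatching M) :
    M.card ≤ G.matchingNumber := by
  classical
  -- Boundedness is essential: `sSup` of an unbounded set of naturals is `0`.
  exact le_csSup ⟨Fintype.card (Sym2 V), by rintro _ ⟨M, -, rfl⟩; exact Finset.card_le_univ M⟩
    ⟨M, hM, rfl⟩

open Classical in
lemma sum_matchings_eq_sum_numMatchings {V : Type*} [Fintype V] [DecidableEq V]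
    {G : SimpleGraph V} {R : Type*} [Semiring R] (F : ℕ → R) :
    ∑ M : Finset (Sym2 V) with G.IsEdgeMatching M, F M.card =
      ∑ i ∈ Finset.range (G.matchingNumber + 1), (G.numMatchings i : R) * F i := by
  rw [← Finset.sum_fiberwise_of_maps_to (g := Finset.card)
    (t := Finset.range (G.matchingNumber + 1))]
  · refine Finset.sum_congr rfl fun i _ => ?_
    have h : G.numMatchings i =
        (Finset.univ.filter fun M => G.IsEdgeMatching M ∧ M.card = i).card := by
      rw [numMatchings, ← Set.ncard_coe_finset]
      simp
    rw [h, Finset.filter_filter, ← nsmul_eq_mul]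
    refine Finset.sum_eq_card_nsmul fun M hM => ?_
    rw [(Finset.mem_filter.mp hM).2.2]
  · intro M hM
    exact Finset.mem_range_succ_iff.mpr (Finset.mem_filter.mp hM).2.card_le_matchingNumber

end SimpleGraph

/-- The permanental polynomial of a gain graph without cycles is its matching polynomial with all
signs positive. -/
lemma Matrix.IsGainMatrix.permanentalPoly_of_isAcyclic {V : Type*} [Fintype V] [DecidableEq V]
    {A : Matrix V V ℂ} {G : SimpleGraph V} (hA : A.IsGainMatrix G)
    (hG : ∀ (u : V) (p : G.Walk u u), ¬ p.IsCycle) :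
    A.permanentalPoly = ∑ i ∈ Finset.range (G.matchingNumber + 1),
      (G.numMatchings i : ℂ[X]) * X ^ (Fintype.card V - 2 * i) := by
  classical
  rw [← SimpleGraph.sum_matchings_eq_sum_numMatchings
      (fun i => (X : ℂ[X]) ^ (Fintype.card V - 2 * i)),
    ← SimpleGraph.sum_involutive_eq_sum_matchings (fun i => (X : ℂ[X]) ^ (Fintype.card V - i)),
    Matrix.permanentalPoly, Matrix.permanent, Finset.sum_filter]
  refine Finset.sum_congr rfl fun σ _ => ?_
  split_ifs with h
  · exact hA.prod_charmatrix_of_involutive h.2 h.1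
  · refine hA.prod_charmatrix_eq_zero fun hσ => h ⟨fun v => ?_, hσ⟩
    by_contra hv
    obtain ⟨u, p, hp, -⟩ := SimpleGraph.exists_isCycle_of_perm hσ hv
    exact hG u p hp

/-! ### The rotation along a cycle. -/

/-- A permutation which agrees with a cyclic permutation `c` at one point moved by `c`, maps every
such point to a neighbour of it, and swaps no two of them, agrees with `c` at all of them. -/
lemma Equiv.Perm.IsCycle.eqOn_of_apply_eq {V : Type*} [Finite V] {σ c : Equiv.Perm V}
    (hc : c.IsCycle)
    (hσ : ∀ w, c w ≠ w → σ (σ w) ≠ w ∧ (σ w = c w ∨ σ w = c.symm w))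
    {v : V} (hv : c v ≠ v) (hvc : σ v = c v) : ∀ w, c w ≠ w → σ w = c w := by
  have key : ∀ k : ℕ, c ((c ^ k) v) ≠ (c ^ k) v ∧ σ ((c ^ k) v) = c ((c ^ k) v) := by
    intro k
    induction k with
    | zero => exact ⟨hv, hvc⟩
    | succ k ih =>
      have hmem : c ((c ^ (k + 1)) v) ≠ (c ^ (k + 1)) v := by
        rw [pow_succ', Equiv.Perm.mul_apply]
        exact c.injective.ne ih.1
      -- Turning back right after a step along `c` would make `σ` swap two consecutive points.
      refine ⟨hmem, ((hσ _ hmem).2).resolve_right fun h => ?_⟩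
      rw [pow_succ', Equiv.Perm.mul_apply, Equiv.symm_apply_apply, ← ih.2] at h
      exact (hσ _ ih.1).1 h
  intro w hw
  obtain ⟨k, rfl⟩ := hc.exists_pow_eq hv hw
  exact (key k).2

namespace SimpleGraph.Walk

variable {V : Type*} {G : SimpleGraph V} {u : V} {C : G.Walk u u}

lemma IsCycle.mem_support_tail_iff (hC : C.IsCycle) {w : V} :
    w ∈ C.support.tail ↔ w ∈ C.support := by
  refine ⟨List.mem_of_mem_tail, fun h => ?_⟩
  rw [← cons_tail_support, List.mem_cons] at h
  rcases h with rfl | h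
  · exact C.end_mem_tail_support hC.not_nil
  · exact h

variable [DecidableEq V]

/-- The permutation which moves every vertex of a cycle to the next one. -/
def rotation (C : G.Walk u u) : Equiv.Perm V := C.support.tail.formPerm

lemma IsCycle.isCycle_rotation (hC : C.IsCycle) : C.rotation.IsCycle :=
  List.isCycle_formPerm hC.support_nodup (by
    have := hC.three_le_length
    have : C.support.tail.length = C.length := by simp
    omega)

lemma IsCycle.rotation_apply_ne_iff (hC : C.IsCycle) {w : V} :
    C.rotation w ≠ w ↔ w ∈ C.support := by
  rw [← hC.mem_support_tail_iff]
  have := List.support_formPerm_of_nodup' C.support.tail hC.support_nodup (by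
    intro x hx
    have h1 : C.support.tail.length = C.length := by simp
    have h2 := hC.three_le_length
    rw [hx] at h1
    simp at h1
    omega)
  exact (Set.ext_iff.mp this w).trans (by simp)

lemma IsCycle.rotation_getVert (hC : C.IsCycle) {i : ℕ} (hi : i < C.length) :
    C.rotation (C.getVert i) = C.getVert (i + 1) := by
  have hl : C.support.tail.length = C.length := by simp
  -- Entry `j` of `support.tail` is vertex `j + 1` of the walk. Vertex `0` is therefore reached as
  -- vertex `C.length`, with `j = C.length - 1`.
  have key : ∀ (j : ℕ) (_ : j < C.length),
      C.rotation (C.getVert (j + 1)) = C.getVert ((j + 1) % C.length + 1) := by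
    intro j hj
    have := List.formPerm_apply_getElem C.support.tail hC.support_nodup j (by omega)
    simpa [rotation, List.getElem_tail, support_getElem_eq_getVert, hl] using this
  rcases i with _ | i
  · have := key (C.length - 1) (by omega)
    rw [Nat.sub_add_cancel (by omega), Nat.mod_self, getVert_length] at this
    simpa using this
  · have := key i (by omega)
    rwa [Nat.mod_eq_of_lt hi] at this

lemma IsCycle.rotation_fst_of_mem_darts (hC : C.IsCycle) {d : G.Dart} (hd : d ∈ C.darts) :
    C.rotation d.fst = d.snd := by
  obtain ⟨i, hi, rfl⟩ := List.mem_iff_getElem.mp hd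
  rw [length_darts] at hi
  simpa [darts_getElem_eq_getVert] using hC.rotation_getVert hi

lemma IsCycle.toSubgraph_adj_rotation (hC : C.IsCycle) {w : V} (hw : w ∈ C.support) :
    C.toSubgraph.Adj w (C.rotation w) := by
  obtain ⟨i, rfl, hi⟩ := mem_support_iff_exists_getVert.mp hw
  rcases hi.lt_or_eq with hi | rfl
  · rw [hC.rotation_getVert hi]
    exact C.toSubgraph_adj_getVert hi
  · have h0 : 0 < C.length := by have := hC.three_le_length; omega
    have h1 := hC.rotation_getVert h0
    have h2 := C.toSubgraph_adj_getVert h0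
    rw [getVert_length]
    rw [getVert_zero] at h1 h2
    rwa [h1]

lemma IsCycle.rotation_mem_support_iff (hC : C.IsCycle) {w : V} :
    C.rotation w ∈ C.support ↔ w ∈ C.support := by
  rw [← hC.rotation_apply_ne_iff, ← hC.rotation_apply_ne_iff]
  exact C.rotation.injective.ne_iff

lemma IsCycle.symm_rotation_mem_support_iff (hC : C.IsCycle) {w : V} :
    C.rotation.symm w ∈ C.support ↔ w ∈ C.support := by
  rw [← hC.rotation_mem_support_iff, Equiv.apply_symm_apply]

/-- A power of a cyclic permutation that fixes a moved point is the identity, whereas the order here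
is the length of `C`, at least three. -/
lemma IsCycle.rotation_rotation_ne [Fintype V] (hC : C.IsCycle) {w : V} (hw : w ∈ C.support) :
    C.rotation (C.rotation w) ≠ w := by
  intro h
  have h1 : C.rotation ^ 2 = 1 := hC.isCycle_rotation.pow_eq_one_iff.mpr
    ⟨w, hC.rotation_apply_ne_iff.mpr hw, by simpa [pow_two] using h⟩
  have h2 := orderOf_le_of_pow_eq_one (by norm_num) h1
  have h3 : C.rotation.support = C.support.tail.toFinset := by
    ext w
    rw [Equiv.Perm.mem_support, hC.rotation_apply_ne_iff, List.mem_toFinset,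
      hC.mem_support_tail_iff]
  have h4 : C.support.tail.length = C.length := by simp
  have h5 := hC.three_le_length
  rw [hC.isCycle_rotation.orderOf, h3, List.toFinset_card_of_nodup hC.support_nodup] at h2
  omega

/-- A vertex has exactly two neighbours in a cycle; the successor and the predecessor are distinct,
hence they are all of them. -/
lemma IsCycle.eq_rotation_or_eq_symm [Fintype V] (hC : C.IsCycle) {w x : V}
    (h : C.toSubgraph.Adj w x) : x = C.rotation w ∨ x = C.rotation.symm w := by
  have hw : w ∈ C.support := C.mem_verts_toSubgraph.mp (C.toSubgraph.edge_vert h)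
  have h1 := hC.toSubgraph_adj_rotation hw
  have h2 := (hC.toSubgraph_adj_rotation (hC.symm_rotation_mem_support_iff.mpr hw)).symm
  rw [Equiv.apply_symm_apply] at h2
  have hne : C.rotation w ≠ C.rotation.symm w := by
    intro h
    apply hC.rotation_rotation_ne hw
    rw [h, Equiv.apply_symm_apply]
  have hsub : ({C.rotation w, C.rotation.symm w} : Set V) ⊆ C.toSubgraph.neighborSet w := by
    rintro y (rfl | rfl)
    · exact h1
    · exact h2
  have heq := Set.eq_of_subset_of_ncard_le hsub (by
    rw [hC.ncard_neighborSet_toSubgraph_eq_two hw, Set.ncard_pair hne])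
    (finite_neighborSet_toSubgraph C)
  have hx : x ∈ C.toSubgraph.neighborSet w := h
  rw [← heq] at hx
  simpa using hx

end SimpleGraph.Walk

/-! ### Consequences of the uniqueness of the cycle. -/

namespace SimpleGraph

variable {V : Type*} {G : SimpleGraph V} {u : V} {C : G.Walk u u}

lemma IsUnicyclic.toSubgraph_eq (hG : G.IsUnicyclic) (hC : C.IsCycle) {v : V} {p : G.Walk v v}
    (hp : p.IsCycle) : p.toSubgraph = C.toSubgraph :=
  hG.unique ⟨v, p, hp, rfl⟩ ⟨u, C, hC, rfl⟩

/-- A cycle of `G - C` maps to a cycle of `G`, which must have the vertices of `C`, yet its base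
point avoids them. -/
lemma IsUnicyclic.not_isCycle_deleteWalkVerts (hG : G.IsUnicyclic) (hC : C.IsCycle)
    (v : {v : V // v ∉ C.support}) (p : (G.deleteWalkVerts C).Walk v v) : ¬ p.IsCycle := by
  intro hp
  let f : G.deleteWalkVerts C →g G := ⟨Subtype.val, fun h => h⟩
  have hp' : (p.map f).IsCycle := hp.map (f := f) Subtype.val_injective
  have h := hG.toSubgraph_eq hC hp'
  have : (v : V) ∈ (p.map f).toSubgraph.verts :=
    (p.map f).mem_verts_toSubgraph.mpr (p.map f).start_mem_support
  rw [h, Walk.mem_verts_toSubgraph] at this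
  exact v.2 this

lemma IsUnicyclic.eqOn_rotation_of_not_involutive [Fintype V] [DecidableEq V]
    (hG : G.IsUnicyclic) (hC : C.IsCycle)
    {σ : Equiv.Perm V} (hσ : ∀ w, σ w ≠ w → G.Adj w (σ w)) (hσ2 : ¬ Function.Involutive σ) :
    (∀ w ∈ C.support, σ w = C.rotation w) ∨ ∀ w ∈ C.support, σ w = C.rotation.symm w := by
  obtain ⟨v, hv⟩ := not_forall.mp hσ2
  obtain ⟨x, p, hp, hvp, h⟩ := exists_isCycle_of_perm hσ hv
  have heq := hG.toSubgraph_eq hC hp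
  have hsupp : ∀ w, w ∈ p.support ↔ w ∈ C.support := by
    intro w
    rw [← Walk.mem_verts_toSubgraph, heq, Walk.mem_verts_toSubgraph]
  have h' : ∀ w ∈ C.support,
      σ (σ w) ≠ w ∧ (σ w = C.rotation w ∨ σ w = C.rotation.symm w) := by
    intro w hw
    have hw' := h w ((hsupp w).mpr hw)
    rw [heq] at hw'
    exact ⟨hw'.1, hC.eq_rotation_or_eq_symm hw'.2⟩
  have hvC := (hsupp v).mp hvp
  have hsymm : ∀ w, C.rotation.symm w ≠ w ↔ w ∈ C.support := by
    intro w
    rw [← hC.rotation_apply_ne_iff, Ne, Equiv.symm_apply_eq, eq_comm]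
  rcases (h' v hvC).2 with hv1 | hv1
  · left
    intro w hw
    exact hC.isCycle_rotation.eqOn_of_apply_eq
      (fun w hw => h' w (hC.rotation_apply_ne_iff.mp hw))
      (hC.rotation_apply_ne_iff.mpr hvC) hv1 w (hC.rotation_apply_ne_iff.mpr hw)
  · right
    intro w hw
    exact Equiv.Perm.IsCycle.eqOn_of_apply_eq (c := C.rotation.symm) hC.isCycle_rotation.inv
      (fun w hw => ⟨(h' w ((hsymm w).mp hw)).1, (h' w ((hsymm w).mp hw)).2.symm⟩)
      ((hsymm v).mpr hvC) hv1 w ((hsymm w).mpr hw)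

end SimpleGraph

/-! ### Contribution of the two rotations. -/

/-- The part of the permanent which comes from the permutations with given values on a set of
vertices invariant under them. -/
lemma Matrix.sum_perm_eqOn {V R : Type*} [Fintype V] [DecidableEq V] [CommRing R]
    (M : Matrix V V R) (p : V → Prop) [DecidablePred p] (c : Equiv.Perm V)
    (hc : ∀ w, p w → c w = w) [DecidablePred fun σ : Equiv.Perm V => ∀ w, ¬ p w → σ w = c w] :
    ∑ σ ∈ Finset.univ.filter (fun σ : Equiv.Perm V => ∀ w, ¬ p w → σ w = c w),
        ∏ i, M (σ i) i =
      (∏ w ∈ Finset.univ.filter (fun w => ¬ p w), M (c w) w) *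
        (M.submatrix (Subtype.val : Subtype p → V) Subtype.val).permanent := by
  rw [Matrix.permanent, Finset.mul_sum]
  symm
  -- The factors act on complementary sets: `c` fixes `p` pointwise and `ofSubtype τ` fixes its
  -- complement.
  refine Finset.sum_bij (fun τ _ => c * Equiv.Perm.ofSubtype τ) ?_ ?_ ?_ ?_
  · intro τ _
    refine Finset.mem_filter.mpr ⟨Finset.mem_univ _, fun w hw => ?_⟩
    rw [Equiv.Perm.mul_apply, Equiv.Perm.ofSubtype_apply_of_not_mem _ hw]
  · intro τ _ τ' _ h
    exact Equiv.Perm.ofSubtype_injective (mul_left_cancel h)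
  · intro σ hσ
    have hσ := (Finset.mem_filter.mp hσ).2
    obtain ⟨τ, hτ⟩ := (Equiv.Perm.subtypeEquivSubtypePerm p).surjective
      ⟨c⁻¹ * σ, fun w hw => by rw [Equiv.Perm.mul_apply, hσ w hw, Equiv.Perm.inv_def,
        Equiv.symm_apply_apply]⟩
    refine ⟨τ, Finset.mem_univ _, ?_⟩
    have : Equiv.Perm.ofSubtype τ = c⁻¹ * σ := congrArg Subtype.val hτ
    rw [this, mul_inv_cancel_left]
  · intro τ _
    rw [← Finset.prod_filter_not_mul_prod_filter Finset.univ p]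
    congr 1
    · refine Finset.prod_congr rfl fun w hw => ?_
      rw [Equiv.Perm.mul_apply,
        Equiv.Perm.ofSubtype_apply_of_not_mem _ (Finset.mem_filter.mp hw).2]
    · rw [Finset.prod_subtype (p := p) _ (by simp)]
      refine Finset.prod_congr rfl fun w _ => ?_
      rw [Equiv.Perm.mul_apply, Equiv.Perm.ofSubtype_apply_coe, hc _ (τ w).2]
      rfl

namespace SimpleGraph

variable {V : Type*} {G : SimpleGraph V}

lemma card_filter_mem_support [Fintype V] [DecidableEq V] {u : V} {C : G.Walk u u}
    (hC : C.IsCycle) :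
    (Finset.univ.filter fun w => ¬ w ∉ C.support).card = C.length := by
  have h : (Finset.univ.filter fun w => ¬ w ∉ C.support) = C.support.tail.toFinset := by
    ext w
    simp [hC.mem_support_tail_iff]
  rw [h, List.toFinset_card_of_nodup hC.support_nodup]
  simp

lemma card_notMem_support [Fintype V] [DecidableEq V] {u : V} {C : G.Walk u u}
    (hC : C.IsCycle) :
    Fintype.card {v : V // v ∉ C.support} = Fintype.card V - C.length := by
  rw [← card_filter_mem_support hC, Fintype.card_subtype]
  have := Finset.card_filter_add_card_filter_not (s := Finset.univ) (fun w => w ∉ C.support)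
  rw [Finset.card_univ] at this
  omega

namespace UnitGain

/-- The gain graph all of whose gains are `1`. -/
noncomputable def trivial (G : SimpleGraph V) : G.UnitGain where
  gain _ := 1
  gain_symm _ := inv_one.symm

lemma walkGain_trivial {u v : V} (p : G.Walk u v) : (trivial G).walkGain p = 1 := by
  simp [walkGain, trivial]

variable [DecidableRel G.Adj]

lemma adjMatrix_trivial : (trivial G).adjMatrix = G.adjMatrix ℂ := by
  ext i j
  simp [UnitGain.adjMatrix, trivial, SimpleGraph.adjMatrix_apply]

lemma adjMatrix_fst_snd (φ : G.UnitGain) (d : G.Dart) :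
    φ.adjMatrix d.fst d.snd = φ.gain d := by
  rw [adjMatrix, Matrix.of_apply, dif_pos d.adj]

lemma isGainMatrix_adjMatrix (φ : G.UnitGain) : φ.adjMatrix.IsGainMatrix G where
  eq_zero i j h := by rw [adjMatrix, Matrix.of_apply, dif_neg h]
  mul_eq_one i j h := by
    let d : G.Dart := ⟨(i, j), h⟩
    have h1 : φ.adjMatrix i j = φ.gain d := φ.adjMatrix_fst_snd d
    have h2 : φ.adjMatrix j i = φ.gain d.symm := φ.adjMatrix_fst_snd d.symm
    rw [h1, h2, φ.gain_symm, ← Circle.coe_mul, mul_inv_cancel, Circle.coe_one]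

variable [Fintype V] [DecidableEq V] {u : V} {C : G.Walk u u}

/-- The permanent uses entries `(σ w, w)`, so the inverse rotation reads each edge from predecessor
to successor, in the direction of `C`; the rotation itself yields the inverse gain. -/
lemma prod_adjMatrix_rotation_symm (φ : G.UnitGain) (hC : C.IsCycle) :
    ∏ w with ¬ w ∉ C.support, φ.adjMatrix (C.rotation.symm w) w = φ.walkGain C := by
  have h : (Finset.univ.filter fun w => ¬ w ∉ C.support) = C.support.tail.toFinset := by
    ext w
    simp [hC.mem_support_tail_iff]
  have hgain : (φ.walkGain C : ℂ) = ((C.darts.map φ.gain).map Circle.coeHom).prod :=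
    map_list_prod Circle.coeHom _
  rw [hgain, h, List.prod_toFinset _ hC.support_nodup, ← Walk.map_snd_darts, List.map_map,
    List.map_map]
  congr 1
  refine List.map_congr_left fun d hd => ?_
  change φ.adjMatrix (C.rotation.symm d.snd) d.snd = φ.gain d
  rw [← φ.adjMatrix_fst_snd, ← hC.rotation_fst_of_mem_darts hd, Equiv.symm_apply_apply]

lemma prod_adjMatrix_rotation (φ : G.UnitGain) (hC : C.IsCycle) :
    ∏ w with ¬ w ∉ C.support, φ.adjMatrix (C.rotation w) w = ((φ.walkGain C)⁻¹ : Circle) := by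
  have h1 : ∏ w with ¬ w ∉ C.support, φ.adjMatrix (C.rotation w) w =
      ∏ w with ¬ w ∉ C.support, φ.adjMatrix w (C.rotation.symm w) := by
    refine Finset.prod_equiv C.rotation (fun w => ?_) (fun w _ => ?_)
    · simp [hC.rotation_mem_support_iff]
    · rw [Equiv.symm_apply_apply]
  rw [h1, Circle.coe_inv, ← φ.prod_adjMatrix_rotation_symm hC, ← Finset.prod_inv_distrib]
  refine Finset.prod_congr rfl fun w hw => ?_
  have hw : w ∈ C.support := not_not.mp (Finset.mem_filter.mp hw).2
  refine eq_inv_of_mul_eq_one_left (φ.isGainMatrix_adjMatrix.mul_eq_one _ _ ?_)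
  have := hC.toSubgraph_adj_rotation (hC.symm_rotation_mem_support_iff.mpr hw)
  rw [Equiv.apply_symm_apply] at this
  exact this.adj_sub.symm

lemma permanent_submatrix_charmatrix (φ : G.UnitGain) (hG : G.IsUnicyclic) (hC : C.IsCycle) :
    (φ.adjMatrix.charmatrix.submatrix (Subtype.val : {v : V // v ∉ C.support} → V)
      Subtype.val).permanent =
    ∑ i ∈ Finset.range ((G.deleteWalkVerts C).matchingNumber + 1),
      ((G.deleteWalkVerts C).numMatchings i : ℂ[X]) *
        X ^ (Fintype.card V - (C.length + 2 * i)) := by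
  have h1 : φ.adjMatrix.charmatrix.submatrix (Subtype.val : {v : V // v ∉ C.support} → V)
      Subtype.val = (φ.adjMatrix.submatrix (Subtype.val : {v : V // v ∉ C.support} → V)
        Subtype.val).charmatrix := by
    ext1 i j
    simp [Matrix.charmatrix_apply, Matrix.diagonal_apply, Subtype.ext_iff]
  have h2 : (φ.adjMatrix.submatrix (Subtype.val : {v : V // v ∉ C.support} → V)
      Subtype.val).IsGainMatrix (G.deleteWalkVerts C) :=
    ⟨fun i j h => φ.isGainMatrix_adjMatrix.eq_zero i j h,
      fun i j h => φ.isGainMatrix_adjMatrix.mul_eq_one i j h⟩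
  have h3 := h2.permanentalPoly_of_isAcyclic (hG.not_isCycle_deleteWalkVerts hC)
  rw [Matrix.permanentalPoly] at h3
  rw [h1, h3, card_notMem_support hC]
  simp only [Nat.sub_sub]

lemma sum_perm_eqOn_cycle (φ : G.UnitGain) (hG : G.IsUnicyclic) (hC : C.IsCycle)
    (c : Equiv.Perm V) (hc : ∀ w, c w ≠ w ↔ w ∈ C.support) :
    ∑ σ : Equiv.Perm V with ∀ w, ¬ w ∉ C.support → σ w = c w,
        ∏ i, φ.adjMatrix.charmatrix (σ i) i =
      (-1) ^ C.length *
        Polynomial.C (∏ w with ¬ w ∉ C.support, φ.adjMatrix (c w) w) *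
        ∑ i ∈ Finset.range ((G.deleteWalkVerts C).matchingNumber + 1),
          ((G.deleteWalkVerts C).numMatchings i : ℂ[X]) *
            X ^ (Fintype.card V - (C.length + 2 * i)) := by
  rw [Matrix.sum_perm_eqOn _ (fun w => w ∉ C.support) c
      (fun w hw => not_not.mp (mt (hc w).mp hw)),
    φ.permanent_submatrix_charmatrix hG hC]
  congr 1
  rw [map_prod, ← card_filter_mem_support hC, ← Finset.prod_neg]
  refine Finset.prod_congr rfl fun w hw => ?_
  rw [Matrix.charmatrix_apply_ne _ _ _ ((hc w).mpr (not_not.mp (Finset.mem_filter.mp hw).2))]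

/-- The permanental polynomial of a unicyclic gain graph, up to a summand which does not depend on
the gains. -/
lemma exists_permanentalPoly_eq (hG : G.IsUnicyclic) (hC : C.IsCycle) :
    ∃ R : ℂ[X], ∀ φ : G.UnitGain, φ.adjMatrix.permanentalPoly = R +
      (-1) ^ C.length *
        Polynomial.C (((φ.walkGain C)⁻¹ : Circle) + (φ.walkGain C : ℂ)) *
        ∑ i ∈ Finset.range ((G.deleteWalkVerts C).matchingNumber + 1),
          ((G.deleteWalkVerts C).numMatchings i : ℂ[X]) *
            X ^ (Fintype.card V - (C.length + 2 * i)) := by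
  let P : Equiv.Perm V → Equiv.Perm V → Prop := fun c σ => ∀ w, ¬ w ∉ C.support → σ w = c w
  have hsymm : ∀ w, C.rotation.symm w ≠ w ↔ w ∈ C.support := by
    intro w
    rw [← hC.rotation_apply_ne_iff, Ne, Equiv.symm_apply_eq, eq_comm]
  have hdisj : ∀ σ, P C.rotation.symm σ → ¬ P C.rotation σ := by
    intro σ h1 h2
    have hu : ¬ u ∉ C.support := not_not.mpr C.start_mem_support
    apply hC.rotation_rotation_ne C.start_mem_support
    rw [← h2 u hu, h1 u hu, Equiv.apply_symm_apply]
  have hsplit : ∀ F : Equiv.Perm V → ℂ[X], ∑ σ, F σ =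
      (∑ σ with ¬ P C.rotation σ ∧ ¬ P C.rotation.symm σ, F σ) +
        (∑ σ with P C.rotation σ, F σ + ∑ σ with P C.rotation.symm σ, F σ) := by
    intro F
    rw [← Finset.sum_filter_add_sum_filter_not Finset.univ (P C.rotation),
      ← Finset.sum_filter_add_sum_filter_not (Finset.univ.filter fun σ => ¬ P C.rotation σ)
        (P C.rotation.symm), Finset.filter_filter, Finset.filter_filter]
    have : (Finset.univ.filter fun σ => ¬ P C.rotation σ ∧ P C.rotation.symm σ) =
        Finset.univ.filter (P C.rotation.symm) :=
      Finset.filter_congr fun σ _ => ⟨fun h => h.2, fun h => ⟨hdisj σ h, h⟩⟩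
    rw [this]
    ring
  -- Trivial gains serve only as a reference: each remaining term is zero or a power of `X`,
  -- whatever the gains.
  refine ⟨∑ σ with ¬ P C.rotation σ ∧ ¬ P C.rotation.symm σ,
    ∏ i, (trivial G).adjMatrix.charmatrix (σ i) i, fun φ => ?_⟩
  rw [Matrix.permanentalPoly, Matrix.permanent, hsplit,
    φ.sum_perm_eqOn_cycle hG hC _ fun _ => hC.rotation_apply_ne_iff,
    φ.sum_perm_eqOn_cycle hG hC _ hsymm, φ.prod_adjMatrix_rotation hC,
    φ.prod_adjMatrix_rotation_symm hC, Polynomial.C_add]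
  congr 1
  · refine Finset.sum_congr rfl fun σ hσ => ?_
    obtain ⟨-, h1, h2⟩ := Finset.mem_filter.mp hσ
    by_cases hadj : ∀ w, σ w ≠ w → G.Adj w (σ w)
    · have hinv : Function.Involutive σ := by
        by_contra h
        rcases hG.eqOn_rotation_of_not_involutive hC hadj h with h | h
        · exact h1 fun w hw => h w (not_not.mp hw)
        · exact h2 fun w hw => h w (not_not.mp hw)
      rw [φ.isGainMatrix_adjMatrix.prod_charmatrix_of_involutive hadj hinv,
        (trivial G).isGainMatrix_adjMatrix.prod_charmatrix_of_involutive hadj hinv]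
    · rw [φ.isGainMatrix_adjMatrix.prod_charmatrix_eq_zero hadj,
        (trivial G).isGainMatrix_adjMatrix.prod_charmatrix_eq_zero hadj]
  · ring

end UnitGain

end SimpleGraph

theorem mainTheorem6 {V : Type*} [Fintype V] [DecidableEq V]
    (G : SimpleGraph V) [DecidableRel G.Adj] (hG : G.IsUnicyclic)
    {u : V} (C : G.Walk u u) (hC : C.IsCycle)
    (φ : G.UnitGain) (θ : ℝ)
    (hθ : (φ.walkGain C : ℂ) = Complex.exp (θ * Complex.I)) :
    Matrix.permanentalPoly φ.adjMatrix =
      Matrix.permanentalPoly (G.adjMatrix ℂ) +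
        (-1) ^ (C.length + 1) * Polynomial.C ((2 * (1 - Real.cos θ) : ℝ) : ℂ) *
          ∑ i ∈ Finset.range ((G.deleteWalkVerts C).matchingNumber + 1),
            ((G.deleteWalkVerts C).numMatchings i : ℂ[X]) *
              X ^ (Fintype.card V - (C.length + 2 * i)) := by
  obtain ⟨R, hR⟩ := SimpleGraph.UnitGain.exists_permanentalPoly_eq hG hC
  -- Written as `2 - …` so that the `2` cancels against `htriv`; the minus sign turns `(-1)^m` into
  -- `(-1)^(m+1)`.
  have hcos : ((φ.walkGain C)⁻¹ : Circle) + (φ.walkGain C : ℂ) =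
      2 - ((2 * (1 - Real.cos θ) : ℝ) : ℂ) := by
    rw [Circle.coe_inv, hθ, ← Complex.exp_neg]
    push_cast
    rw [Complex.cos, neg_mul]
    ring
  have htriv : (((1 : Circle)⁻¹ : Circle) : ℂ) + ((1 : Circle) : ℂ) = 2 := by
    rw [inv_one, Circle.coe_one]
    norm_num
  rw [← SimpleGraph.UnitGain.adjMatrix_trivial, hR φ, hR (SimpleGraph.UnitGain.trivial G),
    SimpleGraph.UnitGain.walkGain_trivial, hcos, htriv, Polynomial.C_sub]
  ring
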